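/- Let $n\ge 2$ and let $\langle x,y\rangle=x_1y_1+\dots+x_ny_n-x_{n+1}y_{n+1}$ on $\mathbb{R}^{n+1}$, $|v|=\sqrt{|\langle v,v\rangle|}$. Let $\mathbb{H}^n=\{x:\langle x,x\rangle=-1,\ x_{n+1}>0\}$ be the hyperbolic space with the induced Riemannian metric; $\nabla u$, $u_i$, $u_{ij}$ denote the gradient and the first and second covariant derivatives of a function $u$ in a local orthonormal frame. Closures and boundaries are taken in $\mathbb{H}^n$, and $\mathcal{C}_{\overline\Omega}=\{\rho q: q\in\overline\Omega,\ \rho>0\}$. As usual, $C^k(\overline\Omega)$ (resp. $C^k(\mathcal{C}_{\overline\Omega})$) consists of the functions of class $C^k$ in $\Omega$ (resp. in the cone over $\Omega$) that extend continuously, together with their derivatives up to order $k$, to $\overline\Omega$ (resp. $\mathcal{C}_{\overline\Omega}$). Let $\Omega$ be a bounded domain of $\mathbb{H}^n$ satisfying a uniform exterior geodesic ball condition: there exist $\sigma>0$ and a map $\Xi:\partial\Omega\to\mathbb{H}^n$ of class $C^2$ such that for every $q_0\in\partial\Omega$ the open geodesic ball $B_\sigma(\xi)$ of radius $\sigma$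 centred at $\xi=\Xi(q_0)\in\mathbb{H}^n\setminus\overline\Omega$ satisfies $q_0\in\partial B_\sigma(\xi)$ and $B_\sigma(\xi)\subset\mathbb{H}^n\setminus\overline\Omega$. Let $H\in C^1(\mathcal{C}_{\overline\Omega})$ be such that $H>0$ and $$\frac{\partial}{\partial\lambda}\bigl(\lambda H(\lambda q)\bigr)\le 0\qquad\text{for all } q\in\overline\Omega,\ \lambda>0.$$ Then $(\Omega,H)$ is admissible, that is: there exists a constant $\theta\in(0,1)$ such that for every $q_0\in\partial\Omega$ and every $t\in[0,1]$ there exist $\varphi_1,\varphi_2\in C^2(\overline\Omega)$ with (i) $\sup_\Omega|\nabla\varphi_i|\le 1-\theta$ for $i=1,2$; (ii) $\varphi_1(q_0)=0$ and $\varphi_1\le 0$ on $\partial\Omega$; (iii) $\varphi_2(q_0)=0$ and $\varphi_2\ge 0$ on $\partial\Omega$; (iv) $\mathcal{Q}^t(\varphi_1)\ge 0$ and $\mathcal{Q}^t(\varphi_2)\le 0$ in $\Omega$, where $$\mathcal{Q}^t(u)=\sum_{i,j=1}^n\bigl((1-|\nabla u|^2)\delta_{ij}+u_iu_j\bigr)u_{ij}-nt(1-|\nabla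 u|^2)+nt(1-|\nabla u|^2)^{3/2}e^{u}H(e^{u}q).$$ -/

import Mathlib

noncomputable section

namespace LorentzMinkowski

/-- The vector space underlying the Lorentz-Minkowski space of dimension `n + 1`;
the last coordinate is the time coordinate. -/
abbrev L (n : ℕ) : Type := EuclideanSpace ℝ (Fin (n + 1))

/-- The Lorentz form `x₁ y₁ + ⋯ + xₙ yₙ - xₙ₊₁ yₙ₊₁`. -/
def form {n : ℕ} (x y : L n) : ℝ :=
  (∑ i : Fin n, x i.castSucc * y i.castSucc) - x (Fin.last n) * y (Fin.last n)

/-- The modulus `|v| = √|⟨v, v⟩|`. -/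
def modulus {n : ℕ} (v : L n) : ℝ := √|form v v|

/-- The hyperbolic space as the upper sheet of the hyperboloid (a closed subset of `L n`). -/
def hyp (n : ℕ) : Set (L n) := {x | form x x = -1 ∧ 0 < x (Fin.last n)}

/-- The geodesic distance of the hyperboloid model, `cosh d(p, q) = -⟨p, q⟩`. -/
def hdist {n : ℕ} (p q : L n) : ℝ := Real.arcosh (-form p q)

/-- The open geodesic ball of radius `r` centred at `c`. -/
def hball {n : ℕ} (c : L n) (r : ℝ) : Set (L n) := {p | p ∈ hyp n ∧ hdist p c < r}

/-- The boundary of `A ⊆ hyp n` relative to the hyperbolic space. As `hyp n` is closed in `L n`,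
closures in the hyperbolic space and in `L n` agree. -/
def hfrontier {n : ℕ} (A : Set (L n)) : Set (L n) := closure A ∩ closure (hyp n \ A)

/-- Bounded domains of the hyperbolic space: relatively open, connected, nonempty, and bounded
for the geodesic distance. -/
structure IsBoundedDomain {n : ℕ} (Ω : Set (L n)) : Prop where
  subset : Ω ⊆ hyp n
  isOpen : ∃ U : Set (L n), IsOpen U ∧ Ω = hyp n ∩ U
  isConnected : IsConnected Ω
  bounded : ∃ R : ℝ, ∀ p ∈ Ω, ∀ q ∈ Ω, hdist p q ≤ R

/-- The cone `{ρ q : q ∈ A, ρ > 0}` spanned by `A`. -/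
def cone {n : ℕ} (A : Set (L n)) : Set (L n) := {x | ∃ q ∈ A, ∃ ρ : ℝ, 0 < ρ ∧ x = ρ • q}

/-- `f ∈ C^k` on the cone over the closure of a relatively open `Ω ⊆ hyp n`: `f` is of class `C^k`
on the (open) cone over `Ω`, and `f` and its derivatives up to order `k` extend continuously to
the cone over the closure, the values of `f` there being those of the extension. -/
def IsCkCone {n : ℕ} (k : ℕ) (Ω : Set (L n)) (f : L n → ℝ) : Prop :=
  ContDiffOn ℝ k f (cone Ω) ∧ ContinuousOn f (cone (closure Ω)) ∧
    ∀ m : ℕ, m ≤ k → ∃ G : L n → ContinuousMultilinearMap ℝ (fun _ : Fin m => L n) ℝ,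
      ContinuousOn G (cone (closure Ω)) ∧ Set.EqOn G (iteratedFDeriv ℝ m f) (cone Ω)

/-- The extension of a function on (a part of) the hyperbolic space that is constant along rays. -/
def radialExt {n : ℕ} (u : L n → ℝ) (x : L n) : ℝ := u ((modulus x)⁻¹ • x)

/-- `u ∈ C^k(Ω̄)` for `Ω` relatively open in the hyperbolic space: `u` is `C^k` in `Ω` and its
derivatives up to order `k` extend continuously to the closure. Since `(ρ, q) ↦ ρ q` is a
diffeomorphism onto the open cone, this is expressed by the extension constant along rays. -/
def IsCkClosure {n : ℕ} (k : ℕ) (Ω : Set (L n)) (u : L n → ℝ) : Prop :=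
  IsCkCone k Ω (radialExt u)

/-- A map of class `C^k` on an arbitrary set `S`: near each point of `S` it is the restriction
of a `C^k` map defined on an open set. -/
def IsCkOnSet {n : ℕ} (k : ℕ) (S : Set (L n)) (f : L n → L n) : Prop :=
  ∀ x ∈ S, ∃ U : Set (L n), IsOpen U ∧ x ∈ U ∧
    ∃ g : L n → L n, ContDiffOn ℝ k g U ∧ Set.EqOn f g (S ∩ U)

/-- The `j`-th vector of the standard basis. -/
def stdVec {n : ℕ} (j : Fin (n + 1)) : L n := EuclideanSpace.single j 1

/-- The gradient of `f` for the Lorentz form, i.e. `⟨lgrad f x, v⟩ = df(x) v` for all `v`. -/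
def lgrad {n : ℕ} (f : L n → ℝ) (x : L n) : L n :=
  (∑ i : Fin n, fderiv ℝ f x (stdVec i.castSucc) • stdVec i.castSucc)
    - fderiv ℝ f x (stdVec (Fin.last n)) • stdVec (Fin.last n)

/-- The gradient of `u` on the hyperbolic space. At `q ∈ hyp n` the differential of `radialExt u`
is `du` on tangent vectors and vanishes on the normal direction `q`, so `grad u q` is the tangent
vector that represents `du` for the induced metric. -/
def grad {n : ℕ} (u : L n → ℝ) : L n → L n := lgrad (radialExt u)

/-- The projection of `L n` onto the tangent space `q^⊥` of the hyperbolic space at `q`. -/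
def tangProj {n : ℕ} (q w : L n) : L n := w + form w q • q

/-- The Levi-Civita connection of the hyperbolic space: the tangential part of the flat
derivative of the vector field `X` in the tangent direction `v`. -/
def covDeriv {n : ℕ} (X : L n → L n) (q v : L n) : L n := tangProj q (fderiv ℝ X q v)

/-- The Hessian `∇²u(v, w) = ⟨∇_v ∇u, w⟩` for tangent vectors `v`, `w` at `q`. -/
def hess {n : ℕ} (u : L n → ℝ) (q v w : L n) : ℝ := form (covDeriv (grad u) q v) w

/-- `e` is an orthonormal basis of the tangent space of the hyperbolic space at `q`. -/
def IsOrthonormalFrame {n : ℕ} (q : L n) (e : Fin n → L n) : Prop :=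
  (∀ i, form (e i) q = 0) ∧ ∀ i j, form (e i) (e j) = if i = j then 1 else 0

/-- The value at `q` of the operator
`∑ᵢⱼ ((1 - |∇u|²) δᵢⱼ + uᵢ uⱼ) uᵢⱼ - n t (1 - |∇u|²) + n t (1 - |∇u|²)^{3/2} e^u H(e^u q)`,
with covariant derivatives `uᵢ`, `uᵢⱼ` taken in the orthonormal frame `e` at `q`; it does not
depend on the frame. -/
def Qop {n : ℕ} (H : L n → ℝ) (t : ℝ) (u : L n → ℝ) (q : L n) (e : Fin n → L n) : ℝ :=
  (∑ i : Fin n, ∑ j : Fin n,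
      ((1 - modulus (grad u q) ^ 2) * (if i = j then 1 else 0)
        + form (grad u q) (e i) * form (grad u q) (e j)) * hess u q (e i) (e j))
    - n * t * (1 - modulus (grad u q) ^ 2)
    + n * t * (1 - modulus (grad u q) ^ 2) ^ (3 / 2 : ℝ)
        * (Real.exp (u q) * H (Real.exp (u q) • q))

/-- `(Ω, H, θ)` is admissible. -/
def IsAdmissibleWith {n : ℕ} (Ω : Set (L n)) (H : L n → ℝ) (θ : ℝ) : Prop :=
  ∀ q₀ ∈ hfrontier Ω, ∀ t ∈ Set.Icc (0 : ℝ) 1, ∃ φ₁ φ₂ : L n → ℝ,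
    IsCkClosure 2 Ω φ₁ ∧ IsCkClosure 2 Ω φ₂ ∧
    (∀ q ∈ Ω, modulus (grad φ₁ q) ≤ 1 - θ) ∧ (∀ q ∈ Ω, modulus (grad φ₂ q) ≤ 1 - θ) ∧
    (φ₁ q₀ = 0 ∧ ∀ q ∈ hfrontier Ω, φ₁ q ≤ 0) ∧
    (φ₂ q₀ = 0 ∧ ∀ q ∈ hfrontier Ω, 0 ≤ φ₂ q) ∧
    (∀ q ∈ Ω, ∀ e, IsOrthonormalFrame q e → 0 ≤ Qop H t φ₁ q e) ∧
    (∀ q ∈ Ω, ∀ e, IsOrthonormalFrame q e → Qop H t φ₂ q e ≤ 0)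

/-- `(Ω, H)` is admissible. -/
def IsAdmissible {n : ℕ} (Ω : Set (L n)) (H : L n → ℝ) : Prop :=
  ∃ θ ∈ Set.Ioo (0 : ℝ) 1, IsAdmissibleWith Ω H θ

/-- The uniform exterior geodesic ball condition. -/
def UniformExteriorBall {n : ℕ} (Ω : Set (L n)) : Prop :=
  ∃ σ : ℝ, 0 < σ ∧ ∃ Ξ : L n → L n, IsCkOnSet 2 (hfrontier Ω) Ξ ∧
    ∀ q₀ ∈ hfrontier Ω, Ξ q₀ ∈ hyp n \ closure Ω ∧ q₀ ∈ hfrontier (hball (Ξ q₀) σ) ∧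
      hball (Ξ q₀) σ ⊆ hyp n \ closure Ω

end LorentzMinkowski

end

/-!
Let `r` be the distance to the centre of an exterior ball of radius `σ` touching `∂Ω` at `q₀`, and
let `f` be the function of `r` vanishing at `σ` with slope `f' = -tanh (C (R - r))`, where `R`
bounds `r` on `Ω`. The barriers are `f ∘ r` and `-f ∘ r`. Since the geodesic spheres have mean
curvature `(n - 1) coth r`, the second order part of `𝒬ᵗ (f ∘ r)` is
`f'' + (n - 1) (1 - f'²) f' coth r`. The identity `f'' = C (1 - f'²)` lets a large `C` absorb both
the curvature term and the terms of order zero, all of which carry a factor `1 - f'²`. What remains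
is the term with `H`: for `f` it has a sign because `H > 0`, and for `-f ≥ 0` the monotonicity
of `λ H(λ q)` gives `e^{-f} H(e^{-f} q) ≤ H(q)`, which is bounded on `Ω`.
-/

noncomputable section

namespace LorentzMinkowski

open scoped Topology

variable {n : ℕ}

/-! ### The Lorentz form -/

/-- The Lorentz form bundled as a continuous bilinear map, so that the calculus of bilinear maps
applies to it. -/
def formL : L n →L[ℝ] L n →L[ℝ] ℝ :=
  (∑ i : Fin n, (EuclideanSpace.proj i.castSucc).smulRight
    (EuclideanSpace.proj i.castSucc : L n →L[ℝ] ℝ))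
  - (EuclideanSpace.proj (Fin.last n)).smulRight (EuclideanSpace.proj (Fin.last n) : L n →L[ℝ] ℝ)

@[simp] lemma formL_apply (x y : L n) : formL x y = form x y := by
  simp [formL, form, sum_apply]

lemma form_comm (x y : L n) : form x y = form y x := by
  simp only [form, mul_comm]

@[simp] lemma form_add_left (x y z : L n) : form (x + y) z = form x z + form y z := by
  simp [← formL_apply]

@[simp] lemma form_add_right (x y z : L n) : form x (y + z) = form x y + form x z := by
  simp [← formL_apply]

@[simp] lemma form_smul_left (a : ℝ) (x y : L n) : form (a • x) y = a * form x y := by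
  simp [← formL_apply]

@[simp] lemma form_smul_right (a : ℝ) (x y : L n) : form x (a • y) = a * form x y := by
  simp [← formL_apply]

@[simp] lemma form_sum_left {ι : Type*} (s : Finset ι) (x : ι → L n) (y : L n) :
    form (∑ i ∈ s, x i) y = ∑ i ∈ s, form (x i) y := by
  simp [← formL_apply, sum_apply]

lemma form_stdVec_castSucc (x : L n) (i : Fin n) : form x (stdVec i.castSucc) = x i.castSucc := by
  simp [form, stdVec, (Fin.castSucc_ne_last _).symm]

lemma form_stdVec_last (x : L n) : form x (stdVec (Fin.last n)) = -x (Fin.last n) := by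
  simp [form, stdVec, Fin.castSucc_ne_last]

lemma contDiff_form_left {k : WithTop ℕ∞} (y : L n) : ContDiff ℝ k fun x => form x y := by
  unfold form; fun_prop

lemma contDiff_form_self {k : WithTop ℕ∞} : ContDiff ℝ k fun x : L n => form x x := by
  unfold form; fun_prop

lemma continuous_form : Continuous fun p : L n × L n => form p.1 p.2 := by
  unfold form; fun_prop

lemma hasFDerivAt_form_left (y x : L n) : HasFDerivAt (fun x => form x y) (formL y) x :=
  (formL y).hasFDerivAt.congr_of_eventuallyEq (.of_forall fun z => by simp [form_comm z y])

lemma hasFDerivAt_form_self (x : L n) :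
    HasFDerivAt (fun x : L n => form x x) ((2 : ℝ) • formL x) x := by
  have h := formL.hasFDerivAt_of_bilinear (hasFDerivAt_id x) (hasFDerivAt_id x)
  simp only [formL_apply, id] at h
  refine h.congr_fderiv ?_
  ext v
  simp [form_comm v x, two_mul]

lemma form_self_add_last_sq_nonneg (x : L n) : 0 ≤ form x x + x (Fin.last n) ^ 2 := by
  simp only [form, ← pow_two, sub_add_cancel]
  positivity

lemma form_add_last_sq_le (x y : L n) :
    (form x y + x (Fin.last n) * y (Fin.last n)) ^ 2
      ≤ (form x x + x (Fin.last n) ^ 2) * (form y y + y (Fin.last n) ^ 2) := by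
  have h := Finset.sum_mul_sq_le_sq_mul_sq Finset.univ
    (fun i : Fin n => x i.castSucc) (fun i => y i.castSucc)
  simpa only [form, ← pow_two, sub_add_cancel] using h

/-! ### The hyperboloid -/

lemma one_le_last {p : L n} (hp : p ∈ hyp n) : 1 ≤ p (Fin.last n) := by
  nlinarith [form_self_add_last_sq_nonneg p, hp.1, hp.2]

lemma isClosed_hyp : IsClosed (hyp n) := by
  have h : hyp n = {x | form x x = -1} ∩ {x : L n | 0 ≤ x (Fin.last n)} := by
    ext x
    refine ⟨fun hx => ⟨hx.1, hx.2.le⟩, fun hx => ⟨hx.1, lt_of_le_of_ne hx.2 fun h0 => ?_⟩⟩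
    have hnonneg := form_self_add_last_sq_nonneg x
    rw [show form x x = -1 from hx.1, ← h0] at hnonneg
    norm_num at hnonneg
  rw [h]
  exact (isClosed_eq (contDiff_form_self (k := 0)).continuous continuous_const).inter
    (isClosed_le continuous_const (by fun_prop))

lemma one_le_neg_form {p q : L n} (hp : p ∈ hyp n) (hq : q ∈ hyp n) : 1 ≤ -form p q := by
  have hcs := form_add_last_sq_le p q
  rw [hp.1, hq.1] at hcs
  have hp1 := one_le_last hp
  have hq1 := one_le_last hq
  set a := p (Fin.last n)
  set b := q (Fin.last n)
  have hab : 1 ≤ a * b := one_le_mul_of_one_le_of_one_le hp1 hq1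
  have : form p q + a * b ≤ a * b - 1 :=
    (abs_le_of_sq_le_sq' (by nlinarith [sq_nonneg (a - b)]) (by linarith)).2
  linarith

lemma form_self_nonneg_of_form_eq_zero {p v : L n} (hp : p ∈ hyp n) (hv : form v p = 0) :
    0 ≤ form v v := by
  have hcs := form_add_last_sq_le v p
  rw [hv, hp.1, zero_add] at hcs
  refine nonneg_of_mul_nonneg_left (b := p (Fin.last n) ^ 2) ?_ (pow_pos hp.2 2)
  nlinarith [form_self_add_last_sq_nonneg v]

lemma form_sq_le_of_form_eq_zero {p v w : L n} (hp : p ∈ hyp n) (hv : form v p = 0)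
    (hw : form w p = 0) : form v w ^ 2 ≤ form v v * form w w := by
  have h := discrim_le_zero (a := form w w) (b := 2 * form v w) (c := form v v) fun s => by
    have hs := form_self_nonneg_of_form_eq_zero hp (v := v + s • w) (by simp [hv, hw])
    simp only [form_add_left, form_add_right, form_smul_left, form_smul_right,
      form_comm w v] at hs
    linarith
  rw [discrim] at h
  linarith

lemma form_tangProj_of_form_eq_zero {q w : L n} (v : L n) (hw : form w q = 0) :
    form (tangProj q v) w = form v w := by
  simp [tangProj, form_comm q w, hw]

lemma form_tangProj_self {q : L n} (hq : q ∈ hyp n) (v : L n) : form (tangProj q v) q = 0 := by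
  simp [tangProj, hq.1]

lemma form_tangProj_tangProj {q : L n} (hq : q ∈ hyp n) (v w : L n) :
    form (tangProj q v) (tangProj q w) = form v w + form v q * form w q := by
  rw [form_comm, tangProj, form_add_left, form_smul_left, form_comm q, form_tangProj_self hq,
    form_comm, tangProj]
  simp [form_comm q w]

lemma IsOrthonormalFrame.sum_form_smul {q : L n} (hq : q ∈ hyp n) {e : Fin n → L n}
    (he : IsOrthonormalFrame q e) {v : L n} (hv : form v q = 0) : ∑ i, form v (e i) • e i = v := by
  have hqe (i : Fin n) : form q (e i) = 0 := by rw [form_comm, he.1]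
  let b : Fin (n + 1) → L n := Fin.snoc e q
  have hb : ∀ i, form (b i) (b i) ≠ 0 := Fin.lastCases (by simp [b, hq.1]) (by simp [b, he.2])
  have hortho : ∀ i j, i ≠ j → form (b i) (b j) = 0 := fun i j => by
    refine Fin.lastCases ?_ (fun i => ?_) i <;> refine Fin.lastCases ?_ (fun j => ?_) j <;>
      simp +contextual [b, he.1, he.2, hqe]
  have hli : LinearIndependent ℝ b :=
    LinearMap.linearIndependent_of_isOrthoᵢ (B := formL.toLinearMap₁₂)
      (fun i j hij => by simpa using hortho i j hij) fun i => by simpa using hb i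
  have hspan : v ∈ Submodule.span ℝ (Set.range b) := by
    rw [hli.span_eq_top_of_card_eq_finrank (by simp)]; trivial
  obtain ⟨a, rfl⟩ := (Submodule.mem_span_range_iff_exists_fun ℝ).1 hspan
  simp only [Fin.sum_univ_castSucc, b, Fin.snoc_castSucc, Fin.snoc_last] at hv ⊢
  have hlast : a (Fin.last n) = 0 := by simpa [he.1, hq.1] using hv
  simp [hlast, he.2]

lemma IsOrthonormalFrame.sum_form_sq {q : L n} (hq : q ∈ hyp n) {e : Fin n → L n}
    (he : IsOrthonormalFrame q e) {v : L n} (hv : form v q = 0) :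
    ∑ i, form v (e i) ^ 2 = form v v := by
  calc ∑ i, form v (e i) ^ 2 = form (∑ i, form v (e i) • e i) v := by
        simp only [form_sum_left, form_smul_left, form_comm (e _) v, pow_two]
    _ = form v v := by rw [he.sum_form_smul hq hv]

/-! ### The geodesic distance -/

lemma cosh_hdist {p q : L n} (hp : p ∈ hyp n) (hq : q ∈ hyp n) :
    Real.cosh (hdist p q) = -form p q := Real.cosh_arcosh (one_le_neg_form hp hq)

lemma hdist_comm (p q : L n) : hdist p q = hdist q p := by
  rw [hdist, form_comm, hdist]

lemma hdist_nonneg {p q : L n} (hp : p ∈ hyp n) (hq : q ∈ hyp n) : 0 ≤ hdist p q :=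
  Real.arcosh_nonneg (one_le_neg_form hp hq)

lemma form_tangProj_self_eq_sinh_sq {p c : L n} (hp : p ∈ hyp n) (hc : c ∈ hyp n) :
    form (tangProj p c) (tangProj p c) = Real.sinh (hdist p c) ^ 2 := by
  rw [form_tangProj_tangProj hp, Real.sinh_sq, cosh_hdist hp hc, hc.1, form_comm c p]
  ring

lemma hdist_triangle {p q c : L n} (hp : p ∈ hyp n) (hq : q ∈ hyp n) (hc : c ∈ hyp n) :
    hdist p q ≤ hdist p c + hdist c q := by
  have hsinh (x : L n) (hx : x ∈ hyp n) : 0 ≤ Real.sinh (hdist c x) :=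
    Real.sinh_nonneg_iff.2 (hdist_nonneg hc hx)
  have hcs := form_sq_le_of_form_eq_zero hc (form_tangProj_self hc p) (form_tangProj_self hc q)
  rw [form_tangProj_self_eq_sinh_sq hc hp, form_tangProj_self_eq_sinh_sq hc hq, ← mul_pow] at hcs
  have hle := (abs_le_of_sq_le_sq' hcs (mul_nonneg (hsinh p hp) (hsinh q hq))).1
  rw [form_tangProj_tangProj hc, form_comm p c, form_comm q c] at hle
  have hcosh : Real.cosh (hdist p q) ≤ Real.cosh (hdist p c + hdist c q) := by
    rw [hdist_comm p c, Real.cosh_add, cosh_hdist hp hq, cosh_hdist hc hp, cosh_hdist hc hq]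
    linarith
  rwa [Real.cosh_le_cosh, abs_of_nonneg (hdist_nonneg hp hq),
    abs_of_nonneg (add_nonneg (hdist_nonneg hp hc) (hdist_nonneg hc hq))] at hcosh

lemma continuousOn_hdist :
    ContinuousOn (fun p : L n × L n => hdist p.1 p.2) (hyp n ×ˢ hyp n) :=
  Real.continuousOn_arcosh.comp continuous_form.neg.continuousOn
    fun _ hp => one_le_neg_form hp.1 hp.2

lemma continuousOn_hdist_left {c : L n} (hc : c ∈ hyp n) :
    ContinuousOn (fun p => hdist p c) (hyp n) :=
  ContinuousOn.comp (g := fun p : L n × L n => hdist p.1 p.2) (f := fun p : L n => (p, c))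
    continuousOn_hdist (by fun_prop) fun _ hp => Set.mk_mem_prod hp hc

lemma isOpen_one_lt_neg_form (c : L n) : IsOpen {x | 1 < -form x c} :=
  isOpen_lt continuous_const (contDiff_form_left (k := 0) c).continuous.neg

lemma contDiffOn_hdist {k : WithTop ℕ∞} (c : L n) :
    ContDiffOn ℝ k (fun p => hdist p c) {x | 1 < -form x c} :=
  Real.contDiffOn_arcosh.comp (contDiff_form_left c).neg.contDiffOn fun _ hx => hx

lemma one_lt_neg_form {p c : L n} (hp : p ∈ hyp n) (hc : c ∈ hyp n) (h : 0 < hdist p c) :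
    1 < -form p c := by
  rw [← cosh_hdist hp hc]
  exact Real.one_lt_cosh.2 h.ne'

lemma hdist_eq_of_mem_hfrontier_hball {c p : L n} {r : ℝ} (hc : c ∈ hyp n)
    (hp : p ∈ hfrontier (hball c r)) : hdist p c = r := by
  have hle : closure (hball c r) ⊆ hyp n ∩ (fun p => hdist p c) ⁻¹' Set.Iic r :=
    closure_minimal (fun q hq => ⟨hq.1, hq.2.le⟩)
      ((continuousOn_hdist_left hc).preimage_isClosed_of_isClosed isClosed_hyp isClosed_Iic)
  have hge : closure (hyp n \ hball c r) ⊆ hyp n ∩ (fun p => hdist p c) ⁻¹' Set.Ici r :=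
    closure_minimal (fun q hq => ⟨hq.1, not_lt.1 fun h => hq.2 ⟨hq.1, h⟩⟩)
      ((continuousOn_hdist_left hc).preimage_isClosed_of_isClosed isClosed_hyp isClosed_Ici)
  exact le_antisymm (hle hp.1).2 (hge hp.2).2

lemma hdist_le_of_mem_closure {A : Set (L n)} (hA : A ⊆ hyp n) {D : ℝ}
    (hD : ∀ p ∈ A, ∀ q ∈ A, hdist p q ≤ D) {p q : L n} (hp : p ∈ closure A) (hq : q ∈ closure A) :
    hdist p q ≤ D := by
  have h : closure (A ×ˢ A) ⊆
      hyp n ×ˢ hyp n ∩ (fun p : L n × L n => hdist p.1 p.2) ⁻¹' Set.Iic D :=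
    closure_minimal (fun x hx => ⟨Set.prod_mono hA hA hx, hD _ hx.1 _ hx.2⟩)
      (continuousOn_hdist.preimage_isClosed_of_isClosed (isClosed_hyp.prod isClosed_hyp)
        isClosed_Iic)
  rw [closure_prod_eq] at h
  exact (h (Set.mk_mem_prod hp hq)).2

lemma norm_le_of_mem_hyp {q : L n} (hq : q ∈ hyp n) : ‖q‖ ≤ 2 * q (Fin.last n) := by
  have h1 := one_le_last hq
  refine (abs_le_of_sq_le_sq' ?_ (by linarith)).2
  have hqq := hq.1
  simp only [form, ← pow_two] at hqq
  rw [EuclideanSpace.real_norm_sq_eq, Fin.sum_univ_castSucc]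
  nlinarith

lemma stdVec_last_mem_hyp : stdVec (Fin.last n) ∈ hyp n := by
  constructor
  · rw [form_stdVec_last]; simp [stdVec]
  · simp [stdVec]

lemma cosh_hdist_stdVec_last {q : L n} (hq : q ∈ hyp n) :
    Real.cosh (hdist q (stdVec (Fin.last n))) = q (Fin.last n) := by
  rw [cosh_hdist hq stdVec_last_mem_hyp, form_stdVec_last, neg_neg]

lemma isCompact_closure_of_hdist_le {A : Set (L n)} (hA : A ⊆ hyp n) {D : ℝ}
    (hD : ∀ p ∈ A, ∀ q ∈ A, hdist p q ≤ D) : IsCompact (closure A) := by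
  obtain rfl | ⟨p, hp⟩ := A.eq_empty_or_nonempty
  · simp
  set o : L n := stdVec (Fin.last n)
  have ho : o ∈ hyp n := stdVec_last_mem_hyp
  refine Bornology.IsBounded.isCompact_closure (isBounded_iff_forall_norm_le.2
    ⟨2 * Real.cosh (D + hdist p o), fun q hq => (norm_le_of_mem_hyp (hA hq)).trans ?_⟩)
  have hle : hdist q o ≤ D + hdist p o :=
    (hdist_triangle (hA hq) ho (hA hp)).trans (by gcongr; exact hD q hq p hp)
  rw [← cosh_hdist_stdVec_last (hA hq)]
  gcongr
  rw [Real.cosh_le_cosh]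
  exact abs_le_abs_of_nonneg (hdist_nonneg (hA hq) ho) hle

/-! ### Extension along rays -/

/-- The cone of timelike vectors, an open neighbourhood of the hyperbolic space on which the
modulus is smooth. -/
def timelike (n : ℕ) : Set (L n) := {x | form x x < 0}

lemma isOpen_timelike : IsOpen (timelike n) :=
  isOpen_lt (contDiff_form_self (k := 0)).continuous continuous_const

lemma hyp_subset_timelike : hyp n ⊆ timelike n := fun x hx => by
  rw [timelike, Set.mem_ofPred, hx.1]
  norm_num

lemma timelike_mem_nhds {q : L n} (hq : q ∈ hyp n) : timelike n ∈ 𝓝 q :=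
  isOpen_timelike.mem_nhds (hyp_subset_timelike hq)

lemma modulus_of_mem_hyp {q : L n} (hq : q ∈ hyp n) : modulus q = 1 := by
  simp [modulus, hq.1]

lemma modulus_of_mem_timelike {x : L n} (hx : x ∈ timelike n) : modulus x = √(-form x x) := by
  rw [modulus, abs_of_neg hx]

lemma modulus_smul (a : ℝ) (x : L n) : modulus (a • x) = |a| * modulus x := by
  rw [modulus, form_smul_left, form_smul_right, ← mul_assoc, abs_mul, abs_mul_self,
    Real.sqrt_mul (mul_self_nonneg a), Real.sqrt_mul_self_eq_abs, modulus]

lemma contDiffOn_inv_modulus {k : WithTop ℕ∞} :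
    ContDiffOn ℝ k (fun x : L n => (modulus x)⁻¹) (timelike n) := by
  have hpos {x : L n} (hx : x ∈ timelike n) : 0 < -form x x := neg_pos.2 hx
  refine ContDiffOn.congr (ContDiffOn.inv
    (contDiff_form_self.neg.contDiffOn.sqrt fun x hx => (hpos hx).ne')
    fun x hx => (Real.sqrt_pos.2 (hpos hx)).ne') fun x hx => ?_
  rw [modulus_of_mem_timelike hx]
  rfl

lemma hasFDerivAt_inv_modulus {x : L n} (hx : x ∈ timelike n) :
    HasFDerivAt (fun x : L n => (modulus x)⁻¹) ((modulus x)⁻¹ ^ 3 • formL x) x := by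
  have hneg : 0 < -form x x := neg_pos.2 hx
  have hsqrt : 0 < √(-form x x) := Real.sqrt_pos.2 hneg
  have h := (hasDerivAt_inv hsqrt.ne').comp_hasFDerivAt x
    ((hasFDerivAt_form_self x).neg.sqrt hneg.ne')
  refine (h.congr_of_eventuallyEq ?_).congr_fderiv ?_
  · filter_upwards [isOpen_timelike.mem_nhds hx] with y hy
    rw [modulus_of_mem_timelike hy]
    rfl
  · ext v
    simp only [modulus_of_mem_timelike hx, smul_apply, neg_apply, formL_apply, smul_eq_mul,
      Pi.neg_apply]
    field_simp

lemma contDiffOn_inv_modulus_smul {k : WithTop ℕ∞} :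
    ContDiffOn ℝ k (fun x : L n => (modulus x)⁻¹ • x) (timelike n) :=
  contDiffOn_inv_modulus.smul contDiffOn_id

lemma inv_modulus_smul_of_mem_hyp {q : L n} (hq : q ∈ hyp n) : (modulus q)⁻¹ • q = q := by
  rw [modulus_of_mem_hyp hq, inv_one, one_smul]

lemma contDiffAt_radialExt {k : WithTop ℕ∞} {u : L n → ℝ} {q : L n} (hq : q ∈ hyp n)
    (hu : ContDiffAt ℝ k u q) : ContDiffAt ℝ k (radialExt u) q := by
  rw [← inv_modulus_smul_of_mem_hyp hq] at hu
  exact hu.comp (f := fun x => (modulus x)⁻¹ • x) q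
    (contDiffOn_inv_modulus_smul.contDiffAt (timelike_mem_nhds hq))

lemma cone_mono {A B : Set (L n)} (h : A ⊆ B) : cone A ⊆ cone B :=
  fun _ ⟨q, hq, hx⟩ => ⟨q, h hq, hx⟩

lemma isCkCone_of_contDiffOn {k : ℕ} {Ω U : Set (L n)} {f : L n → ℝ} (hU : IsOpen U)
    (hf : ContDiffOn ℝ k f U) (hΩ : cone (closure Ω) ⊆ U) : IsCkCone k Ω f := by
  refine ⟨hf.mono ((cone_mono subset_closure).trans hΩ), hf.continuousOn.mono hΩ, fun m hm =>
    ⟨iteratedFDeriv ℝ m f, ContinuousOn.mono ?_ hΩ, fun _ _ => rfl⟩⟩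
  exact (hf.continuousOn_iteratedFDerivWithin (by exact_mod_cast hm) hU.uniqueDiffOn).congr
    fun x hx => (iteratedFDerivWithin_of_isOpen m hU hx).symm

lemma isCkClosure_of_contDiffOn {k : ℕ} {Ω U : Set (L n)} {u : L n → ℝ} (hU : IsOpen U)
    (hu : ContDiffOn ℝ k u U) (hΩU : closure Ω ⊆ U) (hΩ : closure Ω ⊆ hyp n) :
    IsCkClosure k Ω u := by
  have hnorm := contDiffOn_inv_modulus_smul (n := n) (k := k)
  refine isCkCone_of_contDiffOn (hnorm.continuousOn.isOpen_inter_preimage isOpen_timelike hU)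
    (hu.comp (hnorm.mono Set.inter_subset_left) Set.inter_subset_right) ?_
  rintro _ ⟨q, hq, ρ, hρ, rfl⟩
  have hneg : ρ • q ∈ timelike n := by
    rw [timelike, Set.mem_ofPred, form_smul_left, form_smul_right, (hΩ hq).1]
    nlinarith
  have hproj : (modulus (ρ • q))⁻¹ • ρ • q = q := by
    rw [modulus_smul, modulus_of_mem_hyp (hΩ hq), abs_of_pos hρ, mul_one, smul_smul,
      inv_mul_cancel₀ hρ.ne', one_smul]
  exact ⟨hneg, by rw [Set.mem_preimage, hproj]; exact hΩU hq⟩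

/-! ### Gradient and Hessian -/

lemma formL_injective : Function.Injective (formL : L n → L n →L[ℝ] ℝ) := fun x y h => by
  ext j
  have hj := DFunLike.congr_fun h (stdVec j)
  refine Fin.lastCases (fun hj => ?_) (fun i hj => ?_) j hj
  · simpa [form_stdVec_last] using hj
  · simpa [form_stdVec_castSucc] using hj

lemma formL_lgrad (f : L n → ℝ) (x : L n) : formL (lgrad f x) = fderiv ℝ f x := by
  refine ContinuousLinearMap.coe_injective ((EuclideanSpace.basisFun _ ℝ).toBasis.ext fun j => ?_)
  rw [OrthonormalBasis.coe_toBasis, EuclideanSpace.basisFun_apply]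
  rw [ContinuousLinearMap.coe_coe, ContinuousLinearMap.coe_coe, formL_apply, ← stdVec]
  refine Fin.lastCases ?_ (fun i => ?_) j
  · rw [form_stdVec_last]
    simp [lgrad, stdVec, Fin.castSucc_ne_last]
  · rw [form_stdVec_castSucc]
    simp [lgrad, stdVec, Fin.castSucc_ne_last, Pi.single_apply, Fin.castSucc_inj]

lemma lgrad_eq_of_hasFDerivAt {f : L n → ℝ} {x A : L n} (h : HasFDerivAt f (formL A) x) :
    lgrad f x = A :=
  formL_injective ((formL_lgrad f x).trans h.fderiv)

lemma differentiableAt_lgrad {f : L n → ℝ} {x : L n} (h : ContDiffAt ℝ 2 f x) :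
    DifferentiableAt ℝ (lgrad f) x := by
  have hd : DifferentiableAt ℝ (fderiv ℝ f) x :=
    (h.fderiv_right (m := 1) (by norm_num)).differentiableAt (by norm_num)
  unfold lgrad
  fun_prop

section ChainRule

variable {u : L n → ℝ} {f f' : ℝ → ℝ}

lemma hasFDerivAt_radialExt {x : L n} (hu : DifferentiableAt ℝ (radialExt u) x) :
    HasFDerivAt (radialExt u) (formL (grad u x)) x := by
  rw [grad, formL_lgrad]
  exact hu.hasFDerivAt

lemma radialExt_of_mem_hyp (u : L n → ℝ) {q : L n} (hq : q ∈ hyp n) : radialExt u q = u q := by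
  rw [radialExt, inv_modulus_smul_of_mem_hyp hq]

lemma grad_comp {x : L n} {a : ℝ} (hu : DifferentiableAt ℝ (radialExt u) x)
    (hf : HasDerivAt f a (radialExt u x)) : grad (fun q => f (u q)) x = a • grad u x :=
  lgrad_eq_of_hasFDerivAt <|
    (hf.comp_hasFDerivAt x (hasFDerivAt_radialExt hu)).congr_fderiv (map_smul formL a _).symm

lemma hess_of_form_eq_zero {q w : L n} (u : L n → ℝ) (v : L n) (hw : form w q = 0) :
    hess u q v w = form (fderiv ℝ (grad u) q v) w :=
  form_tangProj_of_form_eq_zero _ hw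

lemma hess_comp {q w : L n} {b : ℝ} (hq : q ∈ hyp n) (hu : ContDiffAt ℝ 2 (radialExt u) q)
    (hf : ∀ᶠ s in 𝓝 (u q), HasDerivAt f (f' s) s) (hf' : HasDerivAt f' b (u q)) (v : L n)
    (hw : form w q = 0) :
    hess (fun x => f (u x)) q v w
      = b * form (grad u q) v * form (grad u q) w + f' (u q) * hess u q v w := by
  rw [← radialExt_of_mem_hyp u hq] at hf hf'
  have hgrad : grad (fun x => f (u x)) =ᶠ[𝓝 q] fun x => f' (radialExt u x) • grad u x := by
    filter_upwards [hu.continuousAt.eventually hf,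
      (hu.eventually (by simp)).mono fun x hx => hx.differentiableAt (by norm_num)] with x hfx hux
    exact grad_comp hux hfx
  have hderiv := (hf'.comp_hasFDerivAt q
    (hasFDerivAt_radialExt (hu.differentiableAt (by norm_num)))).smul
      (differentiableAt_lgrad hu).hasFDerivAt
  rw [hess_of_form_eq_zero _ v hw, hess_of_form_eq_zero _ v hw,
    (hderiv.congr_of_eventuallyEq hgrad).fderiv, ← radialExt_of_mem_hyp u hq]
  simp [grad]
  ring

end ChainRule

/-! ### Functions of the distance to a point -/

lemma grad_form_left {x : L n} (hx : x ∈ timelike n) (y : L n) :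
    grad (fun q => form q y) x
      = (modulus x)⁻¹ • y + ((modulus x)⁻¹ ^ 3 * form x y) • x := by
  have hext : radialExt (fun q => form q y) = fun x => (modulus x)⁻¹ * form x y := by
    ext x
    rw [radialExt, form_smul_left]
  rw [grad, hext]
  refine lgrad_eq_of_hasFDerivAt
    (((hasFDerivAt_inv_modulus hx).mul (hasFDerivAt_form_left y x)).congr_fderiv ?_)
  rw [map_add, map_smul, map_smul, smul_smul, mul_comm (form x y)]

lemma grad_form_left_of_mem_hyp {q : L n} (hq : q ∈ hyp n) (y : L n) :
    grad (fun x => form x y) q = tangProj q y := by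
  simp [grad_form_left (hyp_subset_timelike hq), modulus_of_mem_hyp hq, tangProj, form_comm q y]

lemma hess_form_left {q v w : L n} (hq : q ∈ hyp n) (y : L n) (hv : form v q = 0)
    (hw : form w q = 0) : hess (fun x => form x y) q v w = form q y * form v w := by
  have hinv := hasFDerivAt_inv_modulus (hyp_subset_timelike hq)
  have hgrad : grad (fun x => form x y) =ᶠ[𝓝 q] fun x =>
      (modulus x)⁻¹ • y + ((modulus x)⁻¹ ^ 3 * form x y) • x := by
    filter_upwards [timelike_mem_nhds hq] with x hx using grad_form_left hx y
  have hderiv := (hinv.smul_const y).add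
    (((hinv.pow 3).mul (hasFDerivAt_form_left y q)).smul (hasFDerivAt_id q))
  rw [hess_of_form_eq_zero _ v hw, (hderiv.congr_of_eventuallyEq hgrad).fderiv]
  simp [modulus_of_mem_hyp hq, form_comm q v, form_comm q w, hv, hw]

lemma hasDerivAt_arcosh_neg {s : ℝ} (hs : 1 < -s) :
    HasDerivAt (fun s => Real.arcosh (-s)) (-(√(s ^ 2 - 1))⁻¹) s := by
  have h := (Real.hasDerivAt_arcosh hs).comp s (hasDerivAt_neg s)
  rwa [neg_sq, mul_neg_one] at h

lemma hasDerivAt_neg_inv_sqrt_sq_sub_one {s : ℝ} (hs : 1 < -s) :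
    HasDerivAt (fun s : ℝ => -(√(s ^ 2 - 1))⁻¹) (s * (√(s ^ 2 - 1))⁻¹ ^ 3) s := by
  have hpos : 0 < s ^ 2 - 1 := by nlinarith
  have hsqrt := (Real.sqrt_pos.2 hpos).ne'
  refine ((((hasDerivAt_pow 2 s).sub_const 1).sqrt hpos.ne').inv hsqrt).neg.congr_deriv ?_
  field_simp
  simp

section Distance

variable {q c : L n}

lemma sqrt_form_sq_sub_one (hq : q ∈ hyp n) (hc : c ∈ hyp n) :
    √(form q c ^ 2 - 1) = Real.sinh (hdist q c) := by
  rw [hdist, Real.sinh_arcosh (one_le_neg_form hq hc), neg_sq]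

lemma contDiffAt_radialExt_form_left {k : WithTop ℕ∞} (hq : q ∈ hyp n) (y : L n) :
    ContDiffAt ℝ k (radialExt fun x => form x y) q :=
  contDiffAt_radialExt hq (contDiff_form_left y).contDiffAt

lemma contDiffAt_radialExt_hdist {k : WithTop ℕ∞} (hq : q ∈ hyp n) (hc : c ∈ hyp n)
    (hqc : 0 < hdist q c) : ContDiffAt ℝ k (radialExt fun x => hdist x c) q :=
  contDiffAt_radialExt hq <| (contDiffOn_hdist c).contDiffAt <|
    (isOpen_one_lt_neg_form c).mem_nhds (one_lt_neg_form hq hc hqc)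

lemma grad_hdist (hq : q ∈ hyp n) (hc : c ∈ hyp n) (hqc : 0 < hdist q c) :
    grad (fun x => hdist x c) q = -(Real.sinh (hdist q c))⁻¹ • tangProj q c := by
  have hd := hasDerivAt_arcosh_neg (one_lt_neg_form hq hc hqc)
  rw [sqrt_form_sq_sub_one hq hc, ← radialExt_of_mem_hyp (fun x => form x c) hq] at hd
  rw [← grad_form_left_of_mem_hyp hq]
  exact grad_comp (u := fun x => form x c) (f := fun s => Real.arcosh (-s))
    ((contDiffAt_radialExt_form_left (k := 1) hq c).differentiableAt (by norm_num)) hd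

lemma form_grad_hdist_self (hq : q ∈ hyp n) (hc : c ∈ hyp n) (hqc : 0 < hdist q c) :
    form (grad (fun x => hdist x c) q) (grad (fun x => hdist x c) q) = 1 := by
  have hsinh := (Real.sinh_pos_iff.2 hqc).ne'
  rw [grad_hdist hq hc hqc, form_smul_left, form_smul_right, form_tangProj_self_eq_sinh_sq hq hc]
  field_simp

lemma form_grad_hdist (hq : q ∈ hyp n) (hc : c ∈ hyp n) (hqc : 0 < hdist q c) :
    form (grad (fun x => hdist x c) q) q = 0 := by
  rw [grad_hdist hq hc hqc, form_smul_left, form_tangProj_self hq, mul_zero]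

lemma hess_hdist {v w : L n} (hq : q ∈ hyp n) (hc : c ∈ hyp n) (hqc : 0 < hdist q c)
    (hv : form v q = 0) (hw : form w q = 0) :
    hess (fun x => hdist x c) q v w
      = Real.cosh (hdist q c) / Real.sinh (hdist q c) * (form v w
        - form (grad (fun x => hdist x c) q) v * form (grad (fun x => hdist x c) q) w) := by
  have hsinh := (Real.sinh_pos_iff.2 hqc).ne'
  have hlt := one_lt_neg_form hq hc hqc
  have hev : ∀ᶠ s in 𝓝 (form q c),
      HasDerivAt (fun s => Real.arcosh (-s)) (-(√(s ^ 2 - 1))⁻¹) s := by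
    filter_upwards [continuous_neg.continuousAt.eventually (lt_mem_nhds hlt)] with s hs
      using hasDerivAt_arcosh_neg hs
  change hess (fun x => Real.arcosh (-form x c)) q v w = _
  rw [hess_comp hq (contDiffAt_radialExt_form_left hq c) hev
    (hasDerivAt_neg_inv_sqrt_sq_sub_one hlt) v hw, grad_form_left_of_mem_hyp hq,
    hess_form_left hq c hv hw, sqrt_form_sq_sub_one hq hc, grad_hdist hq hc hqc, form_smul_left,
    form_smul_left, cosh_hdist hq hc]
  field_simp
  ring

variable {f f' : ℝ → ℝ} {r p b : ℝ}

lemma grad_comp_hdist (hq : q ∈ hyp n) (hc : c ∈ hyp n) (hqc : 0 < hdist q c)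
    (hf : HasDerivAt f p (hdist q c)) :
    grad (fun x => f (hdist x c)) q = p • grad (fun x => hdist x c) q :=
  grad_comp ((contDiffAt_radialExt_hdist (k := 1) hq hc hqc).differentiableAt (by norm_num))
    (by rwa [radialExt_of_mem_hyp _ hq])

lemma modulus_grad_comp_hdist (hq : q ∈ hyp n) (hc : c ∈ hyp n) (hqc : 0 < hdist q c)
    (hf : HasDerivAt f p (hdist q c)) : modulus (grad (fun x => f (hdist x c)) q) = |p| := by
  rw [grad_comp_hdist hq hc hqc hf, modulus_smul, modulus, form_grad_hdist_self hq hc hqc, abs_one,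
    Real.sqrt_one, mul_one]

lemma sum_sum_radial {ι : Type*} [Fintype ι] [DecidableEq ι] {a : ι → ℝ} (ha : ∑ i, a i ^ 2 = 1)
    (P p b k : ℝ) :
    ∑ i, ∑ j, (P * (if i = j then 1 else 0) + p * a i * (p * a j))
        * (b * a i * a j + p * (k * ((if i = j then 1 else 0) - a i * a j)))
      = (P + p ^ 2) * b + (Fintype.card ι - 1) * P * p * k := by
  have hterm (i j : ι) : (P * (if i = j then 1 else 0) + p * a i * (p * a j))
        * (b * a i * a j + p * (k * ((if i = j then 1 else 0) - a i * a j)))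
      = (if i = j then P * p * k + (P * (b - p * k) + p ^ 3 * k) * a i ^ 2 else 0)
        + p ^ 2 * (b - p * k) * a i ^ 2 * a j ^ 2 := by
    split_ifs with hij
    · subst hij
      ring
    · ring
  simp only [hterm, Finset.sum_add_distrib, Finset.sum_ite_eq, Finset.mem_univ, if_true,
    ← Finset.mul_sum, ha, Finset.sum_const, Finset.card_univ, nsmul_eq_mul, mul_one]
  ring

lemma Qop_comp_hdist (H : L n → ℝ) (t : ℝ) (hq : q ∈ hyp n) (hc : c ∈ hyp n)
    (hr : hdist q c = r) (hr0 : 0 < r) (hf : ∀ᶠ s in 𝓝 r, HasDerivAt f (f' s) s)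
    (hf' : HasDerivAt f' b r) {e : Fin n → L n} (he : IsOrthonormalFrame q e) :
    Qop H t (fun x => f (hdist x c)) q e
      = b + (n - 1) * (1 - f' r ^ 2) * f' r * (Real.cosh r / Real.sinh r)
        - n * t * (1 - f' r ^ 2)
        + n * t * (1 - f' r ^ 2) ^ (3 / 2 : ℝ)
          * (Real.exp (f r) * H (Real.exp (f r) • q)) := by
  subst hr
  have hsum : ∑ i, form (grad (fun x => hdist x c) q) (e i) ^ 2 = 1 := by
    rw [he.sum_form_sq hq (form_grad_hdist hq hc hr0), form_grad_hdist_self hq hc hr0]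
  have hess_frame (i j : Fin n) := hess_comp hq (contDiffAt_radialExt_hdist hq hc hr0) hf hf' (e i)
    (he.1 j)
  have hf_at := hf.self_of_nhds
  simp only [Qop, hess_frame, hess_hdist hq hc hr0 (he.1 _) (he.1 _), he.2]
  rw [modulus_grad_comp_hdist hq hc hr0 hf_at, sq_abs, grad_comp_hdist hq hc hr0 hf_at]
  simp only [form_smul_left, sum_sum_radial hsum, Fintype.card_fin]
  ring

lemma Qop_comp_hdist_nonneg {H : L n → ℝ} {t : ℝ} (ht : t ∈ Set.Icc (0 : ℝ) 1) (hq : q ∈ hyp n)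
    (hc : c ∈ hyp n) (hr : hdist q c = r) (hr0 : 0 < r)
    (hf : ∀ᶠ s in 𝓝 r, HasDerivAt f (f' s) s) (hf' : HasDerivAt f' b r) (hf1 : f' r ^ 2 ≤ 1)
    (hb : n * (1 - f' r ^ 2)
      ≤ b + (n - 1) * (1 - f' r ^ 2) * f' r * (Real.cosh r / Real.sinh r))
    (hH : 0 ≤ H (Real.exp (f r) • q)) {e : Fin n → L n} (he : IsOrthonormalFrame q e) :
    0 ≤ Qop H t (fun x => f (hdist x c)) q e := by
  obtain ⟨ht0, ht1⟩ := ht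
  rw [Qop_comp_hdist H t hq hc hr hr0 hf hf' he]
  have : 0 ≤ 1 - f' r ^ 2 := sub_nonneg.2 hf1
  have hterm : 0 ≤ n * t * (1 - f' r ^ 2) ^ (3 / 2 : ℝ)
      * (Real.exp (f r) * H (Real.exp (f r) • q)) := by positivity
  have htn : n * t * (1 - f' r ^ 2) ≤ n * 1 * (1 - f' r ^ 2) := by gcongr
  linarith

lemma Qop_comp_hdist_nonpos {H : L n → ℝ} {t M : ℝ} (ht : t ∈ Set.Icc (0 : ℝ) 1) (hM : 0 ≤ M)
    (hq : q ∈ hyp n) (hc : c ∈ hyp n) (hr : hdist q c = r) (hr0 : 0 < r)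
    (hf : ∀ᶠ s in 𝓝 r, HasDerivAt f (f' s) s) (hf' : HasDerivAt f' b r) (hf1 : f' r ^ 2 ≤ 1)
    (hb : b + (n - 1) * (1 - f' r ^ 2) * f' r * (Real.cosh r / Real.sinh r)
      ≤ -(n * (1 - f' r ^ 2) * M))
    (hH : Real.exp (f r) * H (Real.exp (f r) • q) ≤ M) {e : Fin n → L n}
    (he : IsOrthonormalFrame q e) : Qop H t (fun x => f (hdist x c)) q e ≤ 0 := by
  obtain ⟨ht0, ht1⟩ := ht
  rw [Qop_comp_hdist H t hq hc hr hr0 hf hf' he]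
  have hP : 0 ≤ 1 - f' r ^ 2 := sub_nonneg.2 hf1
  have hpow : (1 - f' r ^ 2) ^ (3 / 2 : ℝ) ≤ 1 - f' r ^ 2 := by
    simpa using Real.rpow_le_rpow_of_exponent_ge' hP (by linarith [sq_nonneg (f' r)])
      zero_le_one (by norm_num : (1 : ℝ) ≤ 3 / 2)
  have hterm := calc
    n * t * (1 - f' r ^ 2) ^ (3 / 2 : ℝ) * (Real.exp (f r) * H (Real.exp (f r) • q))
      ≤ n * t * (1 - f' r ^ 2) ^ (3 / 2 : ℝ) * M := by gcongr
    _ ≤ n * 1 * (1 - f' r ^ 2) * M := by gcongr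
  have : 0 ≤ n * t * (1 - f' r ^ 2) := by positivity
  linarith

lemma isCkClosure_comp_hdist {k : ℕ} {Ω : Set (L n)} (hf : ContDiff ℝ k f) (hc : c ∈ hyp n)
    (hΩ : closure Ω ⊆ hyp n) (hpos : ∀ q ∈ closure Ω, 0 < hdist q c) :
    IsCkClosure k Ω fun x => f (hdist x c) :=
  isCkClosure_of_contDiffOn (isOpen_one_lt_neg_form c) (hf.comp_contDiffOn (contDiffOn_hdist c))
    (fun q hq => one_lt_neg_form (hΩ hq) hc (hpos q hq)) hΩ

end Distance

/-! ### The barrier -/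

lemma hasDerivAt_tanh (x : ℝ) : HasDerivAt Real.tanh (1 - Real.tanh x ^ 2) x := by
  have hcosh := (Real.cosh_pos x).ne'
  have h := ((Real.hasDerivAt_sinh x).div (Real.hasDerivAt_cosh x) hcosh).congr_of_eventuallyEq
    (.of_forall Real.tanh_eq_sinh_div_cosh)
  refine h.congr_deriv ?_
  rw [Real.tanh_eq_sinh_div_cosh]
  field_simp

lemma monotone_tanh : Monotone Real.tanh :=
  monotone_of_hasDerivAt_nonneg hasDerivAt_tanh fun x => sub_nonneg.2 (Real.tanh_sq_lt_one x).le

lemma cosh_div_sinh_le {r σ : ℝ} (hσ : 0 < σ) (hr : σ ≤ r) :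
    Real.cosh r / Real.sinh r ≤ Real.cosh σ / Real.sinh σ := by
  rw [div_le_div_iff₀ (Real.sinh_pos_iff.2 (hσ.trans_le hr)) (Real.sinh_pos_iff.2 hσ)]
  linarith [Real.sinh_sub r σ, Real.sinh_nonneg_iff.2 (sub_nonneg.2 hr)]

/-- The profile of the barrier as a function of the distance `r` to the centre of an exterior ball
of radius `σ`: the primitive of `r ↦ -tanh (C * (R - r))` that vanishes at `r = σ`. -/
def barrier (C R σ r : ℝ) : ℝ :=
  (Real.log (Real.cosh (C * (R - r))) - Real.log (Real.cosh (C * (R - σ)))) / C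

section Barrier

variable {C R σ r : ℝ}

lemma hasDerivAt_barrier (hC : C ≠ 0) (R σ r : ℝ) :
    HasDerivAt (barrier C R σ) (-Real.tanh (C * (R - r))) r := by
  have h := (((((hasDerivAt_id r).const_sub R).const_mul C).cosh.log
    (Real.cosh_pos _).ne').sub_const (Real.log (Real.cosh (C * (R - σ))))).div_const C
  refine h.congr_deriv ?_
  rw [Real.tanh_eq_sinh_div_cosh, id]
  field_simp

lemma hasDerivAt_neg_barrier (hC : C ≠ 0) (R σ r : ℝ) :
    HasDerivAt (fun r => -barrier C R σ r) (Real.tanh (C * (R - r))) r :=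
  (hasDerivAt_barrier hC R σ r).neg.congr_deriv (neg_neg _)

lemma hasDerivAt_tanh_mul_sub (C R r : ℝ) :
    HasDerivAt (fun r => Real.tanh (C * (R - r))) (-(C * (1 - Real.tanh (C * (R - r)) ^ 2))) r :=
  ((hasDerivAt_tanh _).comp r (((hasDerivAt_id r).const_sub R).const_mul C)).congr_deriv
    (by simp only [id]; ring)

lemma contDiff_barrier {k : WithTop ℕ∞} (C R σ : ℝ) : ContDiff ℝ k (barrier C R σ) := by
  have h : ContDiff ℝ k fun r => C * (R - r) := by fun_prop
  exact ((h.cosh.log fun r => (Real.cosh_pos _).ne').sub contDiff_const).div_const C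

lemma barrier_self (C R σ : ℝ) : barrier C R σ σ = 0 := by
  simp [barrier]

lemma barrier_nonpos (hC : 0 < C) (hr : r ∈ Set.Icc σ R) : barrier C R σ r ≤ 0 := by
  have hle : C * (R - r) ≤ C * (R - σ) := by gcongr; exact hr.1
  refine div_nonpos_of_nonpos_of_nonneg (sub_nonpos.2 (Real.log_le_log (Real.cosh_pos _) ?_)) hC.le
  exact Real.cosh_le_cosh.2 (abs_le_abs_of_nonneg (mul_nonneg hC.le (sub_nonneg.2 hr.2)) hle)

lemma tanh_mul_sub_nonneg (hC : 0 ≤ C) (hr : r ≤ R) : 0 ≤ Real.tanh (C * (R - r)) := by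
  rw [← Real.tanh_zero]
  exact monotone_tanh (mul_nonneg hC (sub_nonneg.2 hr))

lemma abs_tanh_mul_sub_le (hC : 0 ≤ C) (hr : r ∈ Set.Icc σ R) :
    |Real.tanh (C * (R - r))| ≤ Real.tanh (C * (R - σ)) := by
  rw [abs_of_nonneg (tanh_mul_sub_nonneg hC hr.2)]
  exact monotone_tanh (by gcongr; exact hr.1)

lemma mul_le_barrier_curvature {M : ℝ} (hσ : 0 < σ) (hC : 0 ≤ C)
    (hCM : n * (Real.cosh σ / Real.sinh σ + M) ≤ C) (hr : r ∈ Set.Icc σ R) :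
    n * (1 - Real.tanh (C * (R - r)) ^ 2) * M
      ≤ C * (1 - Real.tanh (C * (R - r)) ^ 2)
        - (n - 1) * (1 - Real.tanh (C * (R - r)) ^ 2) * Real.tanh (C * (R - r))
          * (Real.cosh r / Real.sinh r) := by
  have hg0 := tanh_mul_sub_nonneg hC hr.2
  have hg1 := (Real.tanh_lt_one (C * (R - r))).le
  have hP := sub_nonneg.2 (Real.tanh_sq_lt_one (C * (R - r))).le
  have hcoth := cosh_div_sinh_le hσ hr.1
  have hcoth0 : 0 ≤ Real.cosh r / Real.sinh r :=
    div_nonneg (Real.cosh_pos r).le (Real.sinh_nonneg_iff.2 (hσ.le.trans hr.1))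
  generalize Real.tanh (C * (R - r)) = g at *
  generalize Real.cosh r / Real.sinh r = k at *
  have hgk : (n - 1) * (g * k) ≤ n * (Real.cosh σ / Real.sinh σ) := calc
    (n - 1) * (g * k) ≤ n * (1 * k) := by gcongr; linarith
    _ ≤ n * (Real.cosh σ / Real.sinh σ) := by rw [one_mul]; gcongr
  nlinarith [mul_nonneg hP (sub_nonneg.2 hgk), mul_nonneg hP (sub_nonneg.2 hCM)]

end Barrier

section BarrierOperator

variable {C R σ M t : ℝ} {H : L n → ℝ} {q c : L n} {e : Fin n → L n}

lemma Qop_barrier_nonneg (ht : t ∈ Set.Icc (0 : ℝ) 1) (hM : 1 ≤ M) (hσ : 0 < σ) (hC : 0 < C)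
    (hCM : n * (Real.cosh σ / Real.sinh σ + M) ≤ C) (hq : q ∈ hyp n) (hc : c ∈ hyp n)
    (hr : hdist q c ∈ Set.Icc σ R) (hH : ∀ s : ℝ, 0 < s → 0 ≤ H (s • q))
    (he : IsOrthonormalFrame q e) : 0 ≤ Qop H t (fun x => barrier C R σ (hdist x c)) q e := by
  have hP := (Real.tanh_sq_lt_one (C * (R - hdist q c))).le
  refine Qop_comp_hdist_nonneg (f' := fun r => -Real.tanh (C * (R - r))) ht hq hc rfl
    (hσ.trans_le hr.1) (.of_forall (hasDerivAt_barrier hC.ne' R σ))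
    (hasDerivAt_tanh_mul_sub C R _).neg (by rwa [neg_sq]) ?_ (hH _ (Real.exp_pos _)) he
  have hcurv := mul_le_barrier_curvature (n := n) hσ hC.le hCM hr
  have hM' := le_mul_of_one_le_right (mul_nonneg n.cast_nonneg (sub_nonneg.2 hP)) hM
  simp only [neg_sq]
  linarith

lemma Qop_neg_barrier_nonpos (ht : t ∈ Set.Icc (0 : ℝ) 1) (hM : 0 ≤ M) (hσ : 0 < σ) (hC : 0 < C)
    (hCM : n * (Real.cosh σ / Real.sinh σ + M) ≤ C) (hq : q ∈ hyp n) (hc : c ∈ hyp n)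
    (hr : hdist q c ∈ Set.Icc σ R) (hHM : H q ≤ M)
    (hanti : AntitoneOn (fun s : ℝ => s * H (s • q)) (Set.Ioi 0)) (he : IsOrthonormalFrame q e) :
    Qop H t (fun x => -barrier C R σ (hdist x c)) q e ≤ 0 := by
  have hHexp : Real.exp (-barrier C R σ (hdist q c))
      * H (Real.exp (-barrier C R σ (hdist q c)) • q) ≤ H q := by
    simpa using hanti (Set.mem_Ioi.2 one_pos) (Set.mem_Ioi.2 (Real.exp_pos _))
      (Real.one_le_exp (neg_nonneg.2 (barrier_nonpos hC hr)))
  refine Qop_comp_hdist_nonpos (f := fun r => -barrier C R σ r)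
    (f' := fun r => Real.tanh (C * (R - r))) ht hM hq hc rfl (hσ.trans_le hr.1)
    (.of_forall (hasDerivAt_neg_barrier hC.ne' R σ)) (hasDerivAt_tanh_mul_sub C R _)
    (Real.tanh_sq_lt_one _).le ?_ (hHexp.trans hHM) he
  linarith [mul_le_barrier_curvature (n := n) hσ hC.le hCM hr]

end BarrierOperator

/-! ### Admissibility -/

lemma isAdmissibleWith_of_exterior_balls {Ω : Set (L n)} (hΩ : closure Ω ⊆ hyp n)
    {C R σ M : ℝ} (hσ : 0 < σ) (hC : 0 < C) (hM : 1 ≤ M)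
    (hCM : n * (Real.cosh σ / Real.sinh σ + M) ≤ C)
    (hball : ∀ q₀ ∈ hfrontier Ω, ∃ c ∈ hyp n, hdist q₀ c = σ ∧
      ∀ q ∈ closure Ω, hdist q c ∈ Set.Icc σ R)
    {H : L n → ℝ} (hHM : ∀ q ∈ Ω, H q ≤ M) (hnonneg : ∀ x ∈ cone Ω, 0 ≤ H x)
    (hanti : ∀ q ∈ Ω, AntitoneOn (fun s : ℝ => s * H (s • q)) (Set.Ioi 0)) :
    IsAdmissibleWith Ω H (1 - Real.tanh (C * (R - σ))) := by
  intro q₀ hq₀ t ht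
  obtain ⟨c, hc, hq₀c, hr⟩ := hball q₀ hq₀
  have hpos (q) (hq : q ∈ closure Ω) : 0 < hdist q c := hσ.trans_le (hr q hq).1
  have hcl {q} (hq : q ∈ Ω) : q ∈ closure Ω := subset_closure hq
  refine ⟨fun q => barrier C R σ (hdist q c), fun q => -barrier C R σ (hdist q c),
    isCkClosure_comp_hdist (contDiff_barrier C R σ) hc hΩ hpos,
    isCkClosure_comp_hdist (contDiff_barrier C R σ).neg hc hΩ hpos, fun q hq => ?_, fun q hq => ?_,
    ⟨by simp only [hq₀c, barrier_self], fun q hq => barrier_nonpos hC (hr q hq.1)⟩,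
    ⟨by simp only [hq₀c, barrier_self, neg_zero],
      fun q hq => neg_nonneg.2 (barrier_nonpos hC (hr q hq.1))⟩,
    fun q hq e he => Qop_barrier_nonneg ht hM hσ hC hCM (hΩ (hcl hq)) hc (hr q (hcl hq))
      (fun s hs => hnonneg _ ⟨q, hq, s, hs, rfl⟩) he,
    fun q hq e he => Qop_neg_barrier_nonpos ht (zero_le_one.trans hM) hσ hC hCM (hΩ (hcl hq)) hc
      (hr q (hcl hq)) (hHM q hq) (hanti q hq) he⟩
  · rw [modulus_grad_comp_hdist (hΩ (hcl hq)) hc (hpos q (hcl hq))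
      (hasDerivAt_barrier hC.ne' R σ _), abs_neg, sub_sub_cancel]
    exact abs_tanh_mul_sub_le hC.le (hr q (hcl hq))
  · rw [modulus_grad_comp_hdist (f := fun r => -barrier C R σ r) (hΩ (hcl hq)) hc
      (hpos q (hcl hq)) (hasDerivAt_neg_barrier hC.ne' R σ _), sub_sub_cancel]
    exact abs_tanh_mul_sub_le hC.le (hr q (hcl hq))

lemma UniformExteriorBall.exists_center {Ω : Set (L n)} (h : UniformExteriorBall Ω)
    (hΩ : closure Ω ⊆ hyp n) :
    ∃ σ > 0, ∀ q₀ ∈ hfrontier Ω, ∃ c ∈ hyp n, hdist q₀ c = σ ∧ ∀ q ∈ closure Ω, σ ≤ hdist q c := by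
  obtain ⟨σ, hσ, Ξ, -, hΞ⟩ := h
  refine ⟨σ, hσ, fun q₀ hq₀ => ?_⟩
  obtain ⟨hc, hq₀c, hdisj⟩ := hΞ q₀ hq₀
  exact ⟨Ξ q₀, hc.1, hdist_eq_of_mem_hfrontier_hball hc.1 hq₀c,
    fun q hq => not_lt.1 fun hlt => (hdisj ⟨hΩ hq, hlt⟩).2 hq⟩

lemma IsCkCone.bddAbove_image {k : ℕ} {Ω : Set (L n)} {H : L n → ℝ} (hH : IsCkCone k Ω H)
    (hΩ : IsCompact (closure Ω)) : BddAbove (H '' Ω) :=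
  (hΩ.bddAbove_image (hH.2.1.mono fun q hq => ⟨q, hq, 1, one_pos, (one_smul ℝ q).symm⟩)).mono
    (Set.image_mono subset_closure)

lemma IsCkCone.antitoneOn_mul_ray {Ω : Set (L n)} {H : L n → ℝ} (hH : IsCkCone 1 Ω H) {q : L n}
    (hq : q ∈ Ω) (hmono : ∀ l : ℝ, 0 < l → deriv (fun s : ℝ => s * H (s • q)) l ≤ 0) :
    AntitoneOn (fun s : ℝ => s * H (s • q)) (Set.Ioi 0) := by
  have hd : DifferentiableOn ℝ (fun s : ℝ => s * H (s • q)) (Set.Ioi 0) :=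
    differentiableOn_id.mul ((hH.1.differentiableOn (by norm_num)).comp
      (f := fun s : ℝ => s • q) (by fun_prop) fun s hs => ⟨q, hq, s, hs, rfl⟩)
  exact antitoneOn_of_deriv_nonpos (convex_Ioi 0) hd.continuousOn (by rwa [interior_Ioi])
    (by rwa [interior_Ioi])

end LorentzMinkowski

end

open LorentzMinkowski in
theorem proposition4p7_general {n : ℕ} {Ω : Set (L n)} (hΩ : Ω ⊆ hyp n)
    (hbdd : ∃ D : ℝ, ∀ p ∈ Ω, ∀ q ∈ Ω, hdist p q ≤ D)
    (hext : ∃ σ > 0, ∀ q₀ ∈ hfrontier Ω, ∃ c ∈ hyp n, hdist q₀ c = σ ∧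
      ∀ q ∈ closure Ω, σ ≤ hdist q c)
    {H : L n → ℝ} (hHbdd : BddAbove (H '' Ω)) (hnonneg : ∀ x ∈ cone Ω, 0 ≤ H x)
    (hanti : ∀ q ∈ Ω, AntitoneOn (fun s : ℝ => s * H (s • q)) (Set.Ioi 0)) :
    IsAdmissible Ω H := by
  obtain ⟨D, hD⟩ := hbdd
  obtain ⟨σ, hσ, hball⟩ := hext
  obtain ⟨M, hM⟩ := hHbdd
  have hcl : closure Ω ⊆ hyp n := closure_minimal hΩ isClosed_hyp
  set R := |D| + σ + 1
  set C := n * (Real.cosh σ / Real.sinh σ + max M 1) + 1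
  have : 0 < Real.cosh σ / Real.sinh σ := div_pos (Real.cosh_pos σ) (Real.sinh_pos_iff.2 hσ)
  have hC : 0 < C := by positivity
  have htanh : 0 < Real.tanh (C * (R - σ)) := by
    have : 0 < R - σ := by simp only [R]; linarith [abs_nonneg D]
    rw [Real.tanh_eq_sinh_div_cosh]
    exact div_pos (Real.sinh_pos_iff.2 (by positivity)) (Real.cosh_pos _)
  refine ⟨1 - Real.tanh (C * (R - σ)), ⟨sub_pos.2 (Real.tanh_lt_one _), sub_lt_self _ htanh⟩,
    isAdmissibleWith_of_exterior_balls hcl hσ hC (le_max_right M 1) (le_add_of_nonneg_right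
      zero_le_one) (fun q₀ hq₀ => ?_) (fun q hq => (hM ⟨q, hq, rfl⟩).trans (le_max_left M 1))
      hnonneg hanti⟩
  obtain ⟨c, hc, hq₀c, hσc⟩ := hball q₀ hq₀
  refine ⟨c, hc, hq₀c, fun q hq => ⟨hσc q hq, ?_⟩⟩
  have htri := hdist_triangle (hcl hq) hc (hcl hq₀.1)
  have hdiam := hdist_le_of_mem_closure hΩ hD hq hq₀.1
  simp only [R]
  linarith [le_abs_self D]

open LorentzMinkowski in
theorem proposition4p7 (n : ℕ) (hn : 2 ≤ n) (Ω : Set (L n)) (hΩ : IsBoundedDomain Ω)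
    (hext : UniformExteriorBall Ω) (H : L n → ℝ) (hH : IsCkCone 1 Ω H)
    (hpos : ∀ x ∈ cone (closure Ω), 0 < H x)
    (hmono : ∀ q ∈ closure Ω, ∀ l : ℝ, 0 < l → deriv (fun s : ℝ => s * H (s • q)) l ≤ 0) :
    IsAdmissible Ω H :=
  have ⟨_, hD⟩ := hΩ.bounded
  proposition4p7_general hΩ.subset hΩ.bounded
    (hext.exists_center (closure_minimal hΩ.subset isClosed_hyp))
    (hH.bddAbove_image (isCompact_closure_of_hdist_le hΩ.subset hD))
    (fun x hx => (hpos x (cone_mono subset_closure hx)).le)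
    fun _ hq => hH.antitoneOn_mul_ray hq (hmono _ (subset_closure hq))
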